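/- Let $\mathcal{H}$ be an infinite-dimensional complex Hilbert space, let $\mathcal{L}(\mathcal{H})$ be the algebra of bounded operators on $\mathcal{H}$ and $\mathcal{P}(\mathcal{L}(\mathcal{H}))$ its lattice of orthogonal projections. A Boolean sector is a maximal Boolean subalgebra of $\mathcal{P}(\mathcal{L}(\mathcal{H}))$, i.e. a maximal one among the distributive sublattices that contain $0$ and $I$ and are closed under $P \mapsto I - P$; it is atomic if each of its nonzero elements dominates a minimal nonzero element of the sector. Let $\mathcal{M} \subseteq \mathcal{L}(\mathcal{H})$ be a maximal abelian von Neumann subalgebra whose projection lattice $\mathcal{P}(\mathcal{M})$ is an atomic Boolean sector. Let $\mathcal{Q}(\mathcal{M})$ be the Stone spectrum of $\mathcal{M}$: its points, the quasipoints, are the maximal dual ideals of the complete lattice $\mathcal{P}(\mathcal{M})$ (a dual ideal being a nonempty, upward closed set of projections that does not contain $0$ and is closed under finite meets), and the sets $\mathcal{Q}_P(\mathcal{M}) = \{\beta \in \mathcal{Q}(\mathcal{M}) : P \in \beta\}$, $P \in \mathcal{P}(\mathcal{M})$, form a base of its topology. The space $\mathcal{Q}(\mathcal{M})$ is compact Hausdorff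 and homeomorphic to the Gelfand spectrum of $\mathcal{M}$ (a character $\tau$ corresponds to the quasipoint $\{P \in \mathcal{P}(\mathcal{M}) : \tau(P) = 1\}$). Via this homeomorphism the Gelfand transformation becomes an isometric $*$-isomorphism $\mathcal{F}_{\mathcal{M}} : \mathcal{M} \to C(\mathcal{Q}(\mathcal{M}))$ with $\mathcal{F}_{\mathcal{M}}(P) = \chi_{\mathcal{Q}_P(\mathcal{M})}$ for all $P \in \mathcal{P}(\mathcal{M})$, where $C(\mathcal{Q}(\mathcal{M}))$ denotes the complex-valued continuous functions with the supremum norm. A quasipoint is atomic if it is of the form $\{Q \in \mathcal{P}(\mathcal{M}) : Q \geq P\}$ with an atom $P$ of $\mathcal{P}(\mathcal{M})$. Let $\mathcal{Q}(\mathcal{M})_{at}$ be the set of atomic quasipoints and $\mathcal{Q}(\mathcal{M})_{c} := \mathcal{Q}(\mathcal{M}) \setminus \mathcal{Q}(\mathcal{M})_{at}$ the set of continuous quasipoints. Then: 1. $\mathcal{Q}(\mathcal{M})_{at}$ is an open, discrete and dense subset of $\mathcal{Q}(\mathcal{M})$. 2. The set $\mathcal{K}(\mathcal{M})$ of all compact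 operators in $\mathcal{M}$ is a selfadjoint ideal of $\mathcal{M}$, the set of all $f \in C(\mathcal{Q}(\mathcal{M}))$ that vanish on $\mathcal{Q}(\mathcal{M})_{c}$ is a selfadjoint ideal of $C(\mathcal{Q}(\mathcal{M}))$, and the restriction of $\mathcal{F}_{\mathcal{M}}$ to $\mathcal{K}(\mathcal{M})$ is an isometric $*$-isomorphism from $\mathcal{K}(\mathcal{M})$ onto that ideal. 3. A function $f \in C(\mathcal{Q}(\mathcal{M}))$ vanishes on $\mathcal{Q}(\mathcal{M})_{c}$ if and only if its restriction to $\mathcal{Q}(\mathcal{M})_{at}$ vanishes at infinity on $\mathcal{Q}(\mathcal{M})_{at}$. -/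

import Mathlib

open Set Filter Topology

/-! ## Lattices: dual ideals, quasipoints, the Stone spectrum, Boolean sectors -/

section Lattices

variable {L : Type*} [CompleteLattice L]

/-- Dual ideals of a complete lattice. -/
structure IsDualIdeal (J : Set L) : Prop where
  nonempty : J.Nonempty
  bot_notMem : ⊥ ∉ J
  inf_mem : ∀ a ∈ J, ∀ b ∈ J, a ⊓ b ∈ J
  mem_of_le : ∀ a ∈ J, ∀ b, a ≤ b → b ∈ J

variable (L) in
/-- The Stone spectrum of a complete lattice: the set of its quasipoints, i.e. of its maximal dual
ideals. -/
def StoneSpectrum : Type _ := {J : Set L // Maximal IsDualIdeal J}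

namespace StoneSpectrum

instance : Membership L (StoneSpectrum L) := ⟨fun β a => a ∈ β.1⟩

/-- The set of all quasipoints that contain `a`. -/
def basicOpen (a : L) : Set (StoneSpectrum L) := {β | a ∈ β}

/-- The topology of the Stone spectrum is generated by the sets `basicOpen a`. -/
instance : TopologicalSpace (StoneSpectrum L) :=
  TopologicalSpace.generateFrom (range basicOpen)

/-- A quasipoint is atomic if it is the principal dual ideal generated by an atom. -/
def IsAtomic (β : StoneSpectrum L) : Prop := ∃ a : L, IsAtom a ∧ ∀ b : L, b ∈ β ↔ a ≤ b

variable (L) in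
/-- The set of atomic quasipoints. -/
def atomicPart : Set (StoneSpectrum L) := {β | β.IsAtomic}

variable (L) in
/-- The set of continuous (i.e. non-atomic) quasipoints. -/
def continuousPart : Set (StoneSpectrum L) := (atomicPart L)ᶜ

theorem isOpen_basicOpen (a : L) : IsOpen (basicOpen a) :=
  TopologicalSpace.isOpen_generateFrom_of_mem ⟨a, rfl⟩

theorem basicOpen_inf (a b : L) : basicOpen (a ⊓ b) = basicOpen a ∩ basicOpen b := by
  ext β
  exact ⟨fun h => ⟨β.2.1.mem_of_le _ h _ inf_le_left, β.2.1.mem_of_le _ h _ inf_le_right⟩,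
    fun h => β.2.1.inf_mem _ h.1 _ h.2⟩

theorem isTopologicalBasis_basicOpen :
    TopologicalSpace.IsTopologicalBasis (range (basicOpen : L → Set (StoneSpectrum L))) where
  exists_subset_inter := by
    rintro _ ⟨a, rfl⟩ _ ⟨b, rfl⟩ β hβ
    exact ⟨_, ⟨a ⊓ b, rfl⟩, by rwa [basicOpen_inf], (basicOpen_inf a b).le⟩
  sUnion_eq := by
    refine eq_univ_of_forall fun β => ?_
    obtain ⟨a, ha⟩ := β.2.1.nonempty
    exact ⟨_, ⟨a, rfl⟩, ha⟩
  eq_generateFrom := rfl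

end StoneSpectrum

variable [Compl L]

/-- Boolean subalgebras of an orthocomplemented lattice: distributive sublattices that
contain `⊥`, `⊤` and are closed under orthocomplementation. -/
structure IsBooleanSubalgebra (B : Set L) : Prop where
  bot_mem : ⊥ ∈ B
  top_mem : ⊤ ∈ B
  inf_mem : ∀ a ∈ B, ∀ b ∈ B, a ⊓ b ∈ B
  sup_mem : ∀ a ∈ B, ∀ b ∈ B, a ⊔ b ∈ B
  compl_mem : ∀ a ∈ B, aᶜ ∈ B
  inf_sup : ∀ a ∈ B, ∀ b ∈ B, ∀ c ∈ B, a ⊓ (b ⊔ c) = (a ⊓ b) ⊔ (a ⊓ c)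

/-- A Boolean sector is a maximal Boolean subalgebra. -/
def IsBooleanSector (B : Set L) : Prop := Maximal IsBooleanSubalgebra B

/-- A Boolean sector is atomic if each of its nonzero elements dominates an atom, i.e. a minimal
nonzero element of the sector. -/
def IsAtomicBooleanSector (B : Set L) : Prop :=
  IsBooleanSector B ∧
    ∀ a ∈ B, a ≠ ⊥ → ∃ b, b ≤ a ∧ Minimal (fun c => c ∈ B ∧ c ≠ ⊥) b

end Lattices

namespace VonNeumannAlgebra

variable {H : Type*} [NormedAddCommGroup H] [InnerProductSpace ℂ H] [CompleteSpace H]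

/-! ## Von Neumann algebras as C⋆-algebras -/

instance instSMulMemClass : SMulMemClass (VonNeumannAlgebra H) ℂ (H →L[ℂ] H) where
  smul_mem {M} c _ hA := M.toStarSubalgebra.smul_mem hA c

instance instIsClosed (M : VonNeumannAlgebra H) : IsClosed (M : Set (H →L[ℂ] H)) := by
  rw [← M.centralizer_centralizer]
  exact Set.isClosed_centralizer _

variable (H) in
/-- The von Neumann algebra of all bounded operators on `H`. -/
noncomputable def full : VonNeumannAlgebra H where
  toStarSubalgebra := ⊤
  centralizer_centralizer' := by
    change Set.centralizer (Set.centralizer Set.univ) = Set.univ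
    rw [Set.centralizer_univ]
    exact Set.eq_univ_of_forall fun A => Set.mem_centralizer_iff.2 fun z hz => hz.comm A

/-- Abelian von Neumann algebras. -/
class IsAbelian (M : VonNeumannAlgebra H) : Prop where
  comm : ∀ A ∈ M, ∀ B ∈ M, A * B = B * A

/-- Maximal abelian von Neumann subalgebras of the algebra of all bounded operators. -/
def IsMaximalAbelian (M : VonNeumannAlgebra H) : Prop :=
  Maximal (IsAbelian (H := H)) M

/-- An abelian von Neumann algebra as a commutative C⋆-algebra. -/
noncomputable instance instCommCStarAlgebra (M : VonNeumannAlgebra H) [hM : M.IsAbelian] :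
    CommCStarAlgebra M :=
  { (inferInstance : CStarAlgebra M) with
    mul_comm := fun A B => Subtype.ext (hM.comm _ A.2 _ B.2) }

/-! ## The projection lattice -/

/-- The orthogonal projections that belong to `M`. -/
def Proj (M : VonNeumannAlgebra H) : Type _ := {P : H →L[ℂ] H // P ∈ M ∧ IsStarProjection P}

namespace Proj

variable {M : VonNeumannAlgebra H}

/-- A projection of `M`, as an element of `M`. -/
def toElem (P : Proj M) : M := ⟨P.1, P.2.1⟩

theorem ext_range {P Q : Proj M} (h : P.1.range = Q.1.range) : P = Q :=
  Subtype.ext (ContinuousLinearMap.IsStarProjection.ext P.2.2 Q.2.2 h)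

/-- Projections are ordered by inclusion of their ranges. -/
instance : PartialOrder (Proj M) :=
  PartialOrder.lift (fun P => P.1.range) (fun _ _ h => ext_range h)

theorem le_def {P Q : Proj M} : P ≤ Q ↔ P.1.range ≤ Q.1.range := Iff.rfl

theorem isClosed_range (P : Proj M) : IsClosed (P.1.range : Set H) :=
  ContinuousLinearMap.IsIdempotentElem.isClosed_range P.2.2.isIdempotentElem

theorem invt_range (P : Proj M) : ∀ y ∈ M.commutant, P.1.range ∈ Module.End.invtSubmodule y :=
  (IsStarProjection.mem_iff P.2.2 M).1 P.2.1

/-- The projection onto a closed subspace that is invariant under the commutant of `M`. -/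
noncomputable def ofSubmodule (M : VonNeumannAlgebra H) (K : Submodule ℂ H)
    (hc : IsClosed (K : Set H)) (hK : ∀ y ∈ M.commutant, K ∈ Module.End.invtSubmodule y) :
    Proj M :=
  haveI : CompleteSpace K := hc.completeSpace_coe
  ⟨K.starProjection, by
    refine (IsStarProjection.mem_iff isStarProjection_starProjection M).2 fun y hy => ?_
    rw [Submodule.range_starProjection]
    exact hK y hy, isStarProjection_starProjection⟩

theorem range_ofSubmodule (K : Submodule ℂ H) (hc : IsClosed (K : Set H))
    (hK : ∀ y ∈ M.commutant, K ∈ Module.End.invtSubmodule y) :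
    (ofSubmodule M K hc hK).1.range = K :=
  haveI : CompleteSpace K := hc.completeSpace_coe
  Submodule.range_starProjection K

/-- The infimum of a set of projections is the projection onto the intersection of the ranges. -/
noncomputable instance : InfSet (Proj M) where
  sInf s := ofSubmodule M (⨅ P ∈ s, P.1.range)
    (by
      simp only [Submodule.coe_iInf]
      exact isClosed_iInter fun P => isClosed_iInter fun _ => P.isClosed_range)
    (by
      intro y hy x hx
      simp only [Submodule.mem_iInf, Submodule.mem_comap] at hx ⊢
      exact fun P hP => P.invt_range y hy (hx P hP))

theorem range_sInf (s : Set (Proj M)) : (sInf s).1.range = ⨅ P ∈ s, P.1.range :=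
  range_ofSubmodule _ _ _

/-- The projections of a von Neumann algebra form a complete lattice. -/
noncomputable instance : CompleteLattice (Proj M) :=
  completeLatticeOfInf (Proj M) fun s => by
    constructor
    · intro P hP
      rw [le_def, range_sInf]
      exact iInf₂_le P hP
    · intro Q hQ
      rw [le_def, range_sInf]
      exact le_iInf₂ fun P hP => hQ hP

/-- The orthocomplement of a projection `P` is `1 - P`. -/
noncomputable instance : Compl (Proj M) :=
  ⟨fun P => ⟨1 - P.1, sub_mem (one_mem M) P.2.1, P.2.2.one_sub⟩⟩

theorem coe_compl (P : Proj M) : Pᶜ.1 = 1 - P.1 := rfl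

theorem apply_eq_self_iff (P : Proj M) (x : H) : P.1 x = x ↔ x ∈ P.1.range := by
  constructor
  · exact fun h => ⟨x, h⟩
  · rintro ⟨y, rfl⟩
    exact congrArg (fun T : H →L[ℂ] H => T y) P.2.2.isIdempotentElem

theorem mul_eq_of_le {P Q : Proj M} (h : P ≤ Q) : Q.1 * P.1 = P.1 := by
  ext x
  exact (Q.apply_eq_self_iff _).2 (h ⟨x, rfl⟩)

theorem range_inf (P Q : Proj M) : (P ⊓ Q).1.range = P.1.range ⊓ Q.1.range := by
  have : P ⊓ Q = sInf {P, Q} := by simp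
  rw [this, range_sInf, iInf_pair]

theorem coe_bot : (⊥ : Proj M).1 = 0 := by
  have h0 : (0 : H →L[ℂ] H) ∈ M ∧ IsStarProjection (0 : H →L[ℂ] H) :=
    ⟨zero_mem M, IsStarProjection.zero _⟩
  have : (⊥ : Proj M) = (⟨0, h0⟩ : Proj M) := by
    refine le_antisymm bot_le ?_
    change (0 : H →L[ℂ] H).range ≤ _
    rintro _ ⟨x, rfl⟩
    exact zero_mem _
  rw [this]

theorem coe_top : (⊤ : Proj M).1 = 1 := by
  have h0 : (1 : H →L[ℂ] H) ∈ M ∧ IsStarProjection (1 : H →L[ℂ] H) :=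
    ⟨one_mem M, IsStarProjection.one _⟩
  have : (⊤ : Proj M) = (⟨1, h0⟩ : Proj M) := by
    refine le_antisymm ?_ le_top
    change _ ≤ (1 : H →L[ℂ] H).range
    rintro x -
    exact ⟨x, rfl⟩
  rw [this]

theorem coe_inf [hM : M.IsAbelian] (P Q : Proj M) : (P ⊓ Q).1 = P.1 * Q.1 := by
  have hc : P.1 * Q.1 = Q.1 * P.1 := hM.comm _ P.2.1 _ Q.2.1
  have hp : IsStarProjection (P.1 * Q.1) := P.2.2.mul Q.2.2 hc
  refine ContinuousLinearMap.IsStarProjection.ext (P ⊓ Q).2.2 hp ?_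
  rw [range_inf]
  ext x
  constructor
  · rintro ⟨h1, h2⟩
    refine ⟨x, ?_⟩
    change P.1 (Q.1 x) = x
    rw [(Q.apply_eq_self_iff x).2 h2, (P.apply_eq_self_iff x).2 h1]
  · rintro ⟨y, rfl⟩
    refine ⟨⟨Q.1 y, rfl⟩, ⟨P.1 y, ?_⟩⟩
    exact congrArg (fun T : H →L[ℂ] H => T y) hc.symm

end Proj

/-! ## The Gelfand transformation on the Stone spectrum -/

section Gelfand

open WeakDual

variable (M : VonNeumannAlgebra H) [hM : M.IsAbelian]

variable {M} in
theorem character_proj (τ : characterSpace ℂ M) (P : Proj M) :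
    τ P.toElem = 0 ∨ τ P.toElem = 1 := by
  have h : τ P.toElem * τ P.toElem = τ P.toElem := by
    rw [← map_mul]
    exact congrArg τ (Subtype.ext P.2.2.isIdempotentElem)
  rcases eq_or_ne (τ P.toElem) 0 with h0 | h0
  · exact Or.inl h0
  · exact Or.inr (mul_left_cancel₀ h0 (by rw [h, mul_one]))

variable {M} in
theorem character_compl (τ : characterSpace ℂ M) (P : Proj M) :
    τ Pᶜ.toElem = 1 - τ P.toElem := by
  rw [← map_one τ, ← map_sub]
  rfl

variable {M} in
theorem inf_compl_eq_bot (P : Proj M) : P ⊓ Pᶜ = ⊥ := by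
  refine Subtype.ext ?_
  rw [Proj.coe_inf, Proj.coe_compl, Proj.coe_bot, mul_sub, mul_one, sub_eq_zero]
  exact P.2.2.isIdempotentElem.symm

/-- A character `τ` of an abelian von Neumann algebra defines the quasipoint of all projections
`P` with `τ P = 1`. -/
noncomputable def quasipointOfCharacter (τ : characterSpace ℂ M) : StoneSpectrum (Proj M) :=
  ⟨{P | τ P.toElem = 1}, by
    constructor
    · refine ⟨⟨⊤, ?_⟩, ?_, ?_, ?_⟩
      · have : (⊤ : Proj M).toElem = 1 := Subtype.ext Proj.coe_top
        simp [this]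
      · have : (⊥ : Proj M).toElem = 0 := Subtype.ext Proj.coe_bot
        simp [this]
      · intro P hP Q hQ
        have : (P ⊓ Q).toElem = P.toElem * Q.toElem := Subtype.ext (Proj.coe_inf P Q)
        simp only [mem_ofPred_eq] at hP hQ ⊢
        rw [this, map_mul, hP, hQ, mul_one]
      · intro P hP Q hPQ
        have : Q.toElem * P.toElem = P.toElem := Subtype.ext (Proj.mul_eq_of_le hPQ)
        simp only [mem_ofPred_eq] at hP ⊢
        rw [← this, map_mul] at hP
        rcases character_proj τ Q with h | h
        · simp [h] at hP
        · exact h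
    · intro J hJ hle P hP
      rcases character_proj τ P with h | h
      · exfalso
        have hc : Pᶜ ∈ J := hle (by simp [character_compl, h])
        exact hJ.bot_notMem (inf_compl_eq_bot P ▸ hJ.inf_mem _ hP _ hc)
      · exact h⟩

variable {M} in
theorem mem_quasipointOfCharacter {τ : characterSpace ℂ M} {P : Proj M} :
    P ∈ quasipointOfCharacter M τ ↔ τ P.toElem = 1 := Iff.rfl

theorem continuous_quasipointOfCharacter : Continuous (quasipointOfCharacter M) := by
  refine continuous_generateFrom_iff.2 ?_
  rintro _ ⟨P, rfl⟩
  have : quasipointOfCharacter M ⁻¹' StoneSpectrum.basicOpen P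
      = {τ : characterSpace ℂ M | τ P.toElem ≠ 0} := by
    ext τ
    change τ P.toElem = 1 ↔ τ P.toElem ≠ 0
    rcases character_proj τ P with h | h <;> simp [h]
  rw [this]
  exact isOpen_ne_fun ((gelfandTransform ℂ M P.toElem).continuous) continuous_const

theorem quasipointOfCharacter_surjective :
    Function.Surjective (quasipointOfCharacter M) := by
  intro β
  let I : Ideal M :=
    { carrier := {A | ∃ P ∈ β, A * P.toElem = 0}
      add_mem' := by
        rintro A B ⟨P, hP, hA⟩ ⟨Q, hQ, hB⟩
        refine ⟨P ⊓ Q, β.2.1.inf_mem _ hP _ hQ, ?_⟩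
        have : (P ⊓ Q).toElem = P.toElem * Q.toElem := Subtype.ext (Proj.coe_inf P Q)
        rw [this]
        calc (A + B) * (P.toElem * Q.toElem)
            = (A * P.toElem) * Q.toElem + (B * Q.toElem) * P.toElem := by ring
          _ = 0 := by rw [hA, hB]; simp
      zero_mem' := by
        obtain ⟨P, hP⟩ := β.2.1.nonempty
        exact ⟨P, hP, zero_mul _⟩
      smul_mem' := by
        rintro C A ⟨P, hP, hA⟩
        exact ⟨P, hP, by rw [smul_eq_mul, mul_assoc, hA, mul_zero]⟩ }
  have hI : I ≠ ⊤ := by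
    rw [Ideal.ne_top_iff_one]
    rintro ⟨P, hP, h⟩
    rw [one_mul] at h
    have : P = ⊥ := Subtype.ext ((congrArg Subtype.val h).trans Proj.coe_bot.symm)
    exact β.2.1.bot_notMem (this ▸ hP)
  obtain ⟨m, hm, hIm⟩ := Ideal.exists_le_maximal I hI
  refine ⟨m.toCharacterSpace, ?_⟩
  have hle : β.1 ⊆ (quasipointOfCharacter M m.toCharacterSpace).1 := by
    intro P hP
    have h1 : Pᶜ.toElem ∈ m := hIm ⟨P, hP, by
      refine Subtype.ext ?_
      change (1 - P.1) * P.1 = 0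
      rw [sub_mul, one_mul, sub_eq_zero]
      exact P.2.2.isIdempotentElem.symm⟩
    have h2 := m.toCharacterSpace_apply_eq_zero_of_mem h1
    rw [character_compl, sub_eq_zero] at h2
    exact h2.symm
  exact Subtype.ext (Subset.antisymm
    (β.2.2 (quasipointOfCharacter M m.toCharacterSpace).2.1 hle) hle)

theorem quasipointOfCharacter_injective :
    Function.Injective (quasipointOfCharacter M) := by
  intro σ τ h
  by_contra hne
  -- disjointly supported elements of the algebra that separate the two characters
  obtain ⟨U, V, hU, hV, hσ, hτ, hUV⟩ := t2_separation hne
  have sep : ∀ (ρ : characterSpace ℂ M) (W : Set (characterSpace ℂ M)), IsOpen W → ρ ∈ W →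
      ∃ f : C(characterSpace ℂ M, ℂ), f ρ ≠ 0 ∧ ∀ x ∉ W, f x = 0 := by
    intro ρ W hW hρ
    obtain ⟨g, hg0, hg1, -⟩ := exists_continuous_zero_one_of_isClosed (s := Wᶜ) (t := {ρ})
      hW.isClosed_compl isClosed_singleton (by simpa using hρ)
    refine ⟨⟨fun x => (g x : ℂ), by fun_prop⟩, ?_, fun x hx => ?_⟩
    · have : g ρ = 1 := hg1 rfl
      simp [this]
    · have : g x = 0 := hg0 hx
      simp [this]
  obtain ⟨f, hf, hf0⟩ := sep σ U hU hσ
  obtain ⟨g, hg, hg0⟩ := sep τ V hV hτ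
  obtain ⟨x, hx⟩ := (gelfandStarTransform M).surjective f
  obtain ⟨y, hy⟩ := (gelfandStarTransform M).surjective g
  have hσx : σ x ≠ 0 := by
    have : σ x = f σ := by rw [← hx]; rfl
    rwa [this]
  have hτy : τ y ≠ 0 := by
    have : τ y = g τ := by rw [← hy]; rfl
    rwa [this]
  have hyx : y * x = 0 := by
    apply (gelfandStarTransform M).injective
    rw [map_mul, hx, hy, map_zero]
    ext ρ
    by_cases hρ : ρ ∈ U
    · have : ρ ∉ V := fun h' => hUV.le_bot ⟨hρ, h'⟩
      simp [hg0 ρ this]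
    · simp [hf0 ρ hρ]
  -- the range projection of `x`
  let K : Submodule ℂ H := x.1.range.topologicalClosure
  let P : Proj M := Proj.ofSubmodule M K (Submodule.isClosed_topologicalClosure _) (by
    intro z hz
    have hcomm : x.1 * z = z * x.1 := mem_commutant_iff.1 hz _ x.2
    have h1 : Set.MapsTo z (x.1.range : Set H) (x.1.range : Set H) := by
      rintro _ ⟨v, rfl⟩
      exact ⟨z v, congrArg (fun T : H →L[ℂ] H => T v) hcomm⟩
    exact fun v hv => h1.closure z.continuous hv)
  have hPK : P.1.range = K := Proj.range_ofSubmodule _ _ _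
  have hPx : P.toElem * x = x := by
    refine Subtype.ext (ContinuousLinearMap.ext fun v => ?_)
    change P.1 (x.1 v) = x.1 v
    rw [Proj.apply_eq_self_iff, hPK]
    exact Submodule.le_topologicalClosure _ ⟨v, rfl⟩
  have hyP : y * P.toElem = 0 := by
    refine Subtype.ext (ContinuousLinearMap.ext fun v => ?_)
    change y.1 (P.1 v) = 0
    have hv : P.1 v ∈ K := by rw [← hPK]; exact ⟨v, rfl⟩
    have hker : K ≤ y.1.ker := by
      refine Submodule.topologicalClosure_minimal _ ?_ y.1.isClosed_ker
      rintro _ ⟨w, rfl⟩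
      exact congrArg (fun T : M => T.1 w) hyx
    exact hker hv
  have hσP : σ P.toElem = 1 := by
    have := congrArg σ hPx
    rw [map_mul] at this
    exact mul_right_cancel₀ hσx (by rw [this, one_mul])
  have hτP : τ P.toElem = 0 := by
    have := congrArg τ hyP
    rw [map_mul, map_zero] at this
    exact (mul_eq_zero.1 this).resolve_left hτy
  have : P ∈ quasipointOfCharacter M τ := h ▸ mem_quasipointOfCharacter.2 hσP
  rw [mem_quasipointOfCharacter, hτP] at this
  exact zero_ne_one this

instance instT2SpaceStoneSpectrum : T2Space (StoneSpectrum (Proj M)) := by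
  refine ⟨fun β γ hne => ?_⟩
  have : ∃ P ∈ β, P ∉ γ := by
    by_contra! hcon
    exact hne (Subtype.ext (Subset.antisymm hcon (β.2.2 γ.2.1 hcon)))
  obtain ⟨P, hP, hPγ⟩ := this
  have hPc : Pᶜ ∈ γ := by
    obtain ⟨τ, rfl⟩ := quasipointOfCharacter_surjective M γ
    rw [mem_quasipointOfCharacter] at hPγ ⊢
    rw [character_compl, (character_proj τ P).resolve_right hPγ, sub_zero]
  refine ⟨_, _, StoneSpectrum.isOpen_basicOpen P, StoneSpectrum.isOpen_basicOpen Pᶜ, hP, hPc, ?_⟩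
  refine Set.disjoint_left.2 fun δ h1 h2 => ?_
  exact δ.2.1.bot_notMem (inf_compl_eq_bot P ▸ δ.2.1.inf_mem _ h1 _ h2)

instance instCompactSpaceStoneSpectrum : CompactSpace (StoneSpectrum (Proj M)) :=
  (quasipointOfCharacter_surjective M).compactSpace (continuous_quasipointOfCharacter M)

/-- The Gelfand spectrum of an abelian von Neumann algebra is homeomorphic to its Stone
spectrum. -/
noncomputable def gelfandSpectrumHomeomorph : characterSpace ℂ M ≃ₜ StoneSpectrum (Proj M) :=
  Continuous.homeoOfEquivCompactToT2
    (f := Equiv.ofBijective (quasipointOfCharacter M)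
      ⟨quasipointOfCharacter_injective M, quasipointOfCharacter_surjective M⟩)
    (continuous_quasipointOfCharacter M)

/-- The Gelfand transformation of an abelian von Neumann algebra `M`, regarded as a map onto the
continuous functions on the Stone spectrum of `M`:
`gelfand M A β = τ A`, where `τ` is the character with `τ P = 1` for all projections `P ∈ β`. -/
noncomputable def gelfand : M ≃⋆ₐ[ℂ] C(StoneSpectrum (Proj M), ℂ) :=
  (gelfandStarTransform M).trans
    ((gelfandSpectrumHomeomorph M).symm.compStarAlgEquiv' ℂ ℂ)

theorem gelfand_apply (A : M) (β : StoneSpectrum (Proj M)) :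
    gelfand M A β = (gelfandSpectrumHomeomorph M).symm β A := rfl

open Classical in
/-- The Gelfand transform of a projection `P` is the characteristic function of the set of
quasipoints that contain `P`. -/
theorem gelfand_proj (P : Proj M) (β : StoneSpectrum (Proj M)) :
    gelfand M P.toElem β = if P ∈ β then 1 else 0 := by
  obtain ⟨τ, rfl⟩ := (gelfandSpectrumHomeomorph M).surjective β
  rw [gelfand_apply, Homeomorph.symm_apply_apply]
  change τ P.toElem = if τ P.toElem = 1 then 1 else 0
  rcases character_proj τ P with h | h <;> simp [h]

end Gelfand

/-! ## The two ideals -/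

/-- The adjoint of a compact operator on a Hilbert space is compact. -/
theorem isCompactOperator_star {A : H →L[ℂ] H} (hA : IsCompactOperator A) :
    IsCompactOperator (star A : H →L[ℂ] H) := by
  have hAA : IsCompactOperator (A * star A : H →L[ℂ] H) := hA.comp_clm (star A)
  obtain ⟨C, hC, hsub⟩ := IsCompactOperator.image_closedBall_subset_compact
    (f := ((A * star A : H →L[ℂ] H) : H →ₗ[ℂ] H)) hAA 1
  refine (isCompactOperator_iff_isCompact_closure_image_closedBall
    ((star A : H →L[ℂ] H) : H →ₗ[ℂ] H) one_pos).2 ?_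
  refine TotallyBounded.isCompact_of_isClosed (TotallyBounded.closure ?_) isClosed_closure
  refine Metric.totallyBounded_of_finite_discretization fun ε hε => ?_
  obtain ⟨t, ht, hCt⟩ := Metric.totallyBounded_iff.1 hC.totallyBounded (ε ^ 2 / 4) (by positivity)
  have : Fintype t := ht.fintype
  choose u hu using fun x : ((star A : H →L[ℂ] H) : H →ₗ[ℂ] H) '' Metric.closedBall 0 1 => x.2
  have hex : ∀ x, ∃ c : t, (A * star A : H →L[ℂ] H) (u x) ∈ Metric.ball (c : H) (ε ^ 2 / 4) := by
    intro x
    obtain ⟨c, hc, h⟩ := mem_iUnion₂.1 (hCt (hsub ⟨u x, (hu x).1, rfl⟩))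
    exact ⟨⟨c, hc⟩, h⟩
  choose F hF using hex
  refine ⟨t, inferInstance, F, fun x y hxy => ?_⟩
  have hd : ‖(A * star A : H →L[ℂ] H) (u x - u y)‖ < ε ^ 2 / 2 := by
    rw [map_sub, ← dist_eq_norm]
    have h1 := Metric.mem_ball.1 (hF x)
    have h2 := Metric.mem_ball'.1 (hF y)
    rw [← hxy] at h2
    linarith [dist_triangle ((A * star A : H →L[ℂ] H) (u x)) (F x : H)
      ((A * star A : H →L[ℂ] H) (u y))]
  have hn : ‖u x - u y‖ ≤ 2 := by
    have h1 := mem_closedBall_zero_iff.1 (hu x).1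
    have h2 := mem_closedBall_zero_iff.1 (hu y).1
    linarith [norm_sub_le (u x) (u y)]
  have hsq : ‖(star A : H →L[ℂ] H) (u x - u y)‖ ^ 2
      ≤ ‖(A * star A : H →L[ℂ] H) (u x - u y)‖ * ‖u x - u y‖ := by
    rw [(star A : H →L[ℂ] H).apply_norm_sq_eq_inner_adjoint_left (u x - u y),
      ← ContinuousLinearMap.star_eq_adjoint, star_star]
    exact (Complex.re_le_norm _).trans (norm_inner_le_norm _ _)
  have hxy' : dist (x : H) y = ‖(star A : H →L[ℂ] H) (u x - u y)‖ := by
    rw [map_sub, dist_eq_norm, ← (hu x).2, ← (hu y).2]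
    rfl
  rw [hxy']
  have : ‖(star A : H →L[ℂ] H) (u x - u y)‖ ^ 2 < ε ^ 2 := by
    have := norm_nonneg ((A * star A : H →L[ℂ] H) (u x - u y))
    nlinarith [norm_nonneg (u x - u y)]
  exact lt_of_pow_lt_pow_left₀ 2 hε.le this

/-- The compact operators in an abelian von Neumann algebra `M`. -/
def compactIdeal (M : VonNeumannAlgebra H) : NonUnitalStarSubalgebra ℂ M where
  carrier := {A | IsCompactOperator (A : H →L[ℂ] H)}
  add_mem' hA hB := hA.add hB
  zero_mem' := isCompactOperator_zero
  mul_mem' {_ B} hA _ := hA.comp_clm (B : H →L[ℂ] H)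
  smul_mem' c _ hA := hA.smul c
  star_mem' hA := isCompactOperator_star hA

/-- The continuous functions on the Stone spectrum of `M` that vanish on all continuous
quasipoints. -/
def vanishingIdeal (M : VonNeumannAlgebra H) :
    NonUnitalStarSubalgebra ℂ C(StoneSpectrum (Proj M), ℂ) where
  carrier := {f | ∀ β ∈ StoneSpectrum.continuousPart (Proj M), f β = 0}
  add_mem' hf hg β hβ := by simp [hf β hβ, hg β hβ]
  zero_mem' _ _ := rfl
  mul_mem' hf _ β hβ := by simp [hf β hβ]
  smul_mem' c f hf β hβ := by simp [hf β hβ]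
  star_mem' hf β hβ := by simp [hf β hβ]

end VonNeumannAlgebra

/-! ### Atomic quasipoints as isolated points of the Stone spectrum. -/

namespace StoneSpectrum

variable {L : Type*} [CompleteLattice L]

/-! An atom lies in exactly one quasipoint, so atomic quasipoints are isolated; in an atomic lattice
every nonempty basic open set contains one, hence density. By compactness a closed set of isolated
points is finite. So if `f` vanishes on the continuous part, each set `{ε ≤ ‖f‖}` is finite, which
is vanishing at infinity; density gives the converse.

If `A` is compact and its transform is nonzero at `β`, inverting the transform on a clopen
neighbourhood of `β` yields a projection `Q = C * A` in `β`. It is compact, so of finite rank, and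
descent on the rank makes `β` atomic (`gelfand_mem_vanishingIdeal`). Conversely, a function
vanishing on the continuous part is a uniform limit of functions supported on finitely many atomic
quasipoints. These are transforms of linear combinations of atoms, and maximality of `M` makes atoms
rank one (`exists_range_eq_span`). Norm-closedness of the compact operators finishes the argument
(`IsMaximalAbelian.mem_compactIdeal`). -/

theorem exists_mem_of_isAtom {a : L} (ha : IsAtom a) :
    ∃ β : StoneSpectrum L, ∀ b, b ∈ β ↔ a ≤ b := by
  refine ⟨⟨{b | a ≤ b}, ⟨⟨a, le_rfl⟩, ?_, ?_, ?_⟩, ?_⟩, fun b => Iff.rfl⟩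
  · exact fun h => ha.1 (le_bot_iff.1 h)
  · exact fun b hb c hc => le_inf hb hc
  · exact fun b hb c hbc => le_trans hb hbc
  · intro J hJ hle b hb
    -- A member of `J` not above `a` is disjoint from the atom `a`, which also lies in `J`; their
    -- meet would put `⊥` in `J`.
    by_contra hab
    have h0 : a ⊓ b = ⊥ := (ha.not_le_iff_disjoint.1 hab).eq_bot
    exact hJ.bot_notMem (h0 ▸ hJ.inf_mem _ (hle (show a ≤ a from le_rfl)) _ hb)

theorem mem_iff_le_of_isAtom {a : L} (ha : IsAtom a) {β : StoneSpectrum L} (hβ : a ∈ β) (b : L) :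
    b ∈ β ↔ a ≤ b := by
  refine ⟨fun hb => ?_, fun h => β.2.1.mem_of_le _ hβ _ h⟩
  by_contra hab
  exact β.2.1.bot_notMem ((ha.not_le_iff_disjoint.1 hab).eq_bot ▸ β.2.1.inf_mem _ hβ _ hb)

theorem basicOpen_eq_singleton {a : L} (ha : IsAtom a) {β : StoneSpectrum L} (hβ : a ∈ β) :
    basicOpen a = {β} := by
  ext γ
  refine ⟨fun hγ => Subtype.ext (Set.ext fun b => ?_), fun h => h ▸ hβ⟩
  exact (mem_iff_le_of_isAtom ha hγ b).trans (mem_iff_le_of_isAtom ha hβ b).symm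

theorem exists_isAtom_mem {β : StoneSpectrum L} (hβ : β ∈ atomicPart L) :
    ∃ a, IsAtom a ∧ a ∈ β := by
  obtain ⟨a, ha, h⟩ := hβ
  exact ⟨a, ha, (h a).2 le_rfl⟩

theorem mem_atomicPart_of_isAtom {a : L} (ha : IsAtom a) {β : StoneSpectrum L} (hβ : a ∈ β) :
    β ∈ atomicPart L :=
  ⟨a, ha, mem_iff_le_of_isAtom ha hβ⟩

theorem isOpen_singleton_of_mem_atomicPart {β : StoneSpectrum L} (hβ : β ∈ atomicPart L) :
    IsOpen {β} := by
  obtain ⟨a, ha, haβ⟩ := exists_isAtom_mem hβ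
  exact basicOpen_eq_singleton ha haβ ▸ isOpen_basicOpen a

theorem isOpen_of_subset_atomicPart {s : Set (StoneSpectrum L)} (hs : s ⊆ atomicPart L) :
    IsOpen s := by
  rw [← biUnion_of_singleton s]
  exact isOpen_biUnion fun β hβ => isOpen_singleton_of_mem_atomicPart (hs hβ)

variable (L) in
theorem isOpen_atomicPart : IsOpen (atomicPart L) := isOpen_of_subset_atomicPart Subset.rfl

instance discreteTopology_atomicPart : DiscreteTopology (atomicPart L) := by
  refine discreteTopology_iff_isOpen_singleton.2 fun β => ?_
  have := (isOpen_singleton_of_mem_atomicPart β.2).preimage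
    (continuous_subtype_val : Continuous ((↑) : atomicPart L → StoneSpectrum L))
  convert this
  ext γ
  simp [Subtype.ext_iff]

variable (L) in
theorem dense_atomicPart [hL : _root_.IsAtomic L] : Dense (atomicPart L) := by
  refine isTopologicalBasis_basicOpen.dense_iff.2 ?_
  rintro _ ⟨b, rfl⟩ ⟨β, hβ⟩
  have hb : b ≠ ⊥ := fun h => β.2.1.bot_notMem (h ▸ hβ)
  obtain ⟨a, ha, hab⟩ := (hL.eq_bot_or_exists_atom_le b).resolve_left hb
  obtain ⟨γ, hγ⟩ := exists_mem_of_isAtom ha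
  exact ⟨γ, (hγ b).2 hab, a, ha, hγ⟩

/-- A closed set of atomic quasipoints is finite. -/
theorem finite_of_isClosed_of_subset_atomicPart [CompactSpace (StoneSpectrum L)]
    {s : Set (StoneSpectrum L)} (hs : IsClosed s) (hsub : s ⊆ atomicPart L) : s.Finite := by
  refine hs.isCompact.finite (isDiscrete_iff_discreteTopology.2 ?_)
  exact DiscreteTopology.of_subset inferInstance hsub

/-- A continuous function vanishes on the continuous part if and only if its restriction to the
atomic part vanishes at infinity. -/
theorem forall_continuousPart_eq_zero_iff [_root_.IsAtomic L] [CompactSpace (StoneSpectrum L)]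
    [T1Space (StoneSpectrum L)] {E : Type*} [NormedAddCommGroup E] (f : C(StoneSpectrum L, E)) :
    (∀ β ∈ continuousPart L, f β = 0) ↔
      Tendsto (fun β : atomicPart L => f β) (cocompact (atomicPart L)) (𝓝 0) := by
  rw [cocompact_eq_cofinite, Metric.tendsto_nhds]
  constructor
  · intro hf ε hε
    have hfin : {β | ε ≤ ‖f β‖}.Finite := by
      refine finite_of_isClosed_of_subset_atomicPart
        (isClosed_le continuous_const f.continuous.norm) fun β hβ => ?_
      by_contra hc
      simp only [mem_ofPred_eq, hf β hc, norm_zero] at hβ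
      exact absurd hε hβ.not_gt
    refine (hfin.preimage Subtype.val_injective.injOn).subset fun β hβ => ?_
    simpa using hβ
  · intro h β hβ
    by_contra hne
    have hpos : 0 < ‖f β‖ / 2 := by positivity
    -- Only finitely many atomic points carry values of norm at least `‖f β‖ / 2`. Removing them
    -- leaves an open neighbourhood of the continuous point `β`, and density yields one more such
    -- atomic point.
    have hfin := (eventually_cofinite.1 (h _ hpos)).image Subtype.val
    obtain ⟨γ, ⟨hγ, hγF⟩, hγat⟩ := (dense_atomicPart L).inter_open_nonempty
      ({γ | ‖f β‖ / 2 < ‖f γ‖} \ _)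
      ((isOpen_lt continuous_const f.continuous.norm).sdiff hfin.isClosed)
      ⟨β, by simp only [mem_ofPred_eq]; linarith, by
        rintro ⟨δ, -, rfl⟩
        exact hβ δ.2⟩
    refine hγF ⟨⟨γ, hγat⟩, ?_, rfl⟩
    simpa using (show ‖f β‖ / 2 < ‖f γ‖ from hγ).le

end StoneSpectrum

/-! ### Maximality, atomicity of the projection lattice, and compact projections. -/

namespace VonNeumannAlgebra

variable {H : Type*} [NormedAddCommGroup H] [InnerProductSpace ℂ H] [CompleteSpace H]

/-- A maximal abelian von Neumann algebra contains all projections that commute with it. -/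
theorem IsMaximalAbelian.mem_of_commute {M : VonNeumannAlgebra H} (hM : M.IsMaximalAbelian)
    {Q : H →L[ℂ] H} (hQ : IsSelfAdjoint Q) (hQM : ∀ A ∈ M, A * Q = Q * A) : Q ∈ M := by
  have hab := hM.prop
  let S : Set (H →L[ℂ] H) := insert Q M
  have hS : ∀ A ∈ S, star A ∈ S := by
    rintro A (rfl | hA)
    · exact Or.inl hQ
    · exact Or.inr (star_mem hA)
  have hstar : S ∪ star S = S := by
    refine union_eq_left.2 fun A hA => ?_
    simpa using hS _ hA
  have hcomm : ∀ A ∈ S, ∀ C ∈ S, A * C = C * A := by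
    rintro A (rfl | hA) C (rfl | hC)
    · rfl
    · exact (hQM C hC).symm
    · exact hQM A hA
    · exact hab.comm A hA C hC
  have hcoe : ((StarSubalgebra.centralizer ℂ S : StarSubalgebra ℂ (H →L[ℂ] H)) :
      Set (H →L[ℂ] H)) = S.centralizer := by
    rw [StarSubalgebra.coe_centralizer, hstar]
  -- The algebra generated by `M` and `Q` is the bicommutant of `S`, obtained as the commutant of
  -- `C`, whose carrier is `S'`; the identity `S''' = S'` makes `C` a von Neumann algebra.
  let C : VonNeumannAlgebra H :=
    { toStarSubalgebra := StarSubalgebra.centralizer ℂ S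
      centralizer_centralizer' :=
        (congrArg (fun T => Set.centralizer (Set.centralizer T)) hcoe).trans
          ((Set.centralizer_centralizer_centralizer S).trans hcoe.symm) }
  have hC : (C : Set (H →L[ℂ] H)) = S.centralizer := hcoe
  have hC' : (C.commutant : Set (H →L[ℂ] H)) = S.centralizer.centralizer := by
    rw [coe_commutant, hC]
  have hSC : S ⊆ C.commutant := by
    rw [hC']
    exact subset_centralizer_centralizer
  have hCab : IsAbelian C.commutant := ⟨fun A hA D hD => by
    rw [← SetLike.mem_coe, hC'] at hA hD
    exact Set.centralizer_centralizer_comm_of_comm hcomm A hA D hD⟩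
  exact hM.le_of_ge hCab (fun A hA => hSC (Or.inr hA)) (hSC (Or.inl rfl))

namespace Proj

variable {M : VonNeumannAlgebra H}

theorem eq_bot_iff_coe {P : Proj M} : P = ⊥ ↔ P.1 = 0 :=
  ⟨fun h => by rw [h, coe_bot], fun h => Subtype.ext (h.trans coe_bot.symm)⟩

/-- The projection lattice of a von Neumann algebra is atomic if the projections of the algebra
form an atomic Boolean sector. -/
theorem isAtomic_of_isAtomicBooleanSector {B : Set (Proj (full H))}
    (hB : IsAtomicBooleanSector B) (hMB : ∀ P : Proj (full H), P ∈ B ↔ P.1 ∈ M) :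
    IsAtomic (Proj M) := by
  refine ⟨fun P => or_iff_not_imp_left.2 fun hP => ?_⟩
  -- Both lattices are ordered by inclusion of ranges, so minimality in `B` transfers to `Proj M`.
  have toFull : ∀ R : Proj M, ∃ R' ∈ B, R'.1 = R.1 := fun R =>
    ⟨⟨R.1, trivial, R.2.2⟩, (hMB _).2 R.2.1, rfl⟩
  have ne_bot : ∀ {R : Proj M} {R' : Proj (full H)}, R'.1 = R.1 → (R' ≠ ⊥ ↔ R ≠ ⊥) := by
    intro R R' h
    rw [ne_eq, ne_eq, not_iff_not, eq_bot_iff_coe, eq_bot_iff_coe, h]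
  obtain ⟨P', hP'B, hP'⟩ := toFull P
  obtain ⟨Q', hle, ⟨hQB, hQ0⟩, hmin⟩ := hB.2 P' hP'B ((ne_bot hP').2 hP)
  let Q : Proj M := ⟨Q'.1, (hMB _).1 hQB, Q'.2.2⟩
  refine ⟨Q, ⟨(ne_bot (R := Q) rfl).1 hQ0, fun R hR => ?_⟩, ?_⟩
  · by_contra hR0
    obtain ⟨R', hR'B, hR'⟩ := toFull R
    have hle' : R' ≤ Q' := by
      rw [le_def, hR']
      exact le_def.1 hR.le
    have := hmin ⟨hR'B, (ne_bot hR').2 hR0⟩ hle'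
    refine hR.not_ge ?_
    rw [le_def, ← hR']
    exact this
  · rw [le_def, ← hP']
    exact hle

theorem range_ne_bot {P : Proj M} (hP : P ≠ ⊥) : P.1.range ≠ ⊥ := by
  refine fun h => hP (ext_range ?_)
  rw [h, coe_bot]
  exact LinearMap.range_zero.symm

/-- `P` acts as the identity on its closed range, so that identity is compact and Riesz's theorem
applies. -/
theorem finiteDimensional_range {P : Proj M} (hP : IsCompactOperator P.1) :
    FiniteDimensional ℂ P.1.range := by
  refine FiniteDimensional.of_isCompactOperator_id (𝕜 := ℂ) ?_
  have h1 : IsCompactOperator (P.1 ∘L P.1.range.subtypeL) := hP.comp_clm _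
  have h2 := h1.codRestrict (V := P.1.range) (fun x => ⟨x, rfl⟩) P.isClosed_range
  have h3 : (id : P.1.range → P.1.range) =
      Set.codRestrict (P.1 ∘L P.1.range.subtypeL) P.1.range (fun x => ⟨x, rfl⟩) :=
    funext fun x => Subtype.ext ((P.apply_eq_self_iff x).2 x.2).symm
  exact h3 ▸ h2

theorem isCompactOperator {P : Proj M} [FiniteDimensional ℂ P.1.range] :
    IsCompactOperator P.1 := by
  have := FiniteDimensional.proper ℂ P.1.range
  have h : IsCompactOperator (P.1.rangeRestrict) :=
    ⟨_, isCompact_closedBall 0 ‖P.1.rangeRestrict‖, by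
      refine Filter.mem_of_superset (Metric.closedBall_mem_nhds 0 one_pos) fun x hx => ?_
      simp only [mem_closedBall_zero_iff, mem_preimage] at hx ⊢
      exact P.1.rangeRestrict.le_of_opNorm_le_of_le le_rfl hx |>.trans (by simp)⟩
  exact h.clm_comp P.1.range.subtypeL

end Proj

theorem isClosed_compactIdeal (M : VonNeumannAlgebra H) :
    IsClosed (M.compactIdeal : Set M) :=
  (isClosed_setOfPred_isCompactOperator (σ₁₂ := RingHom.id ℂ) (M₁ := H) (M₂ := H)).preimage
    continuous_subtype_val

/-! ### Compact operators versus functions vanishing on the continuous quasipoints. -/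

section Gelfand

variable {M : VonNeumannAlgebra H} [hM : M.IsAbelian]

/-- Every quasipoint comes from a character, and characters take only the values 0 and 1 on
projections. -/
theorem compl_mem_of_notMem {β : StoneSpectrum (Proj M)} {P : Proj M} (hP : P ∉ β) : Pᶜ ∈ β := by
  obtain ⟨τ, rfl⟩ := quasipointOfCharacter_surjective M β
  rw [mem_quasipointOfCharacter] at hP ⊢
  rw [character_compl, (character_proj τ P).resolve_right hP, sub_zero]

theorem isClopen_basicOpen (P : Proj M) : IsClopen (StoneSpectrum.basicOpen P) := by
  refine ⟨⟨?_⟩, StoneSpectrum.isOpen_basicOpen P⟩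
  convert StoneSpectrum.isOpen_basicOpen Pᶜ using 1
  ext β
  refine ⟨compl_mem_of_notMem, fun h1 h2 => ?_⟩
  exact β.2.1.bot_notMem (inf_compl_eq_bot P ▸ β.2.1.inf_mem _ h2 _ h1)

variable (M) in
theorem isometry_gelfand : Isometry (gelfand M) := StarAlgEquiv.isometry (gelfand M)

/-- The transform of an atom is supported at a single point. Hence each vector in the range of `P`
is a common eigenvector of `M`. -/
theorem mul_toElem_of_isAtom {P : Proj M} (hP : IsAtom P) {β : StoneSpectrum (Proj M)}
    (hβ : P ∈ β) (A : M) : A * P.toElem = gelfand M A β • P.toElem := by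
  classical
  refine EquivLike.injective (gelfand M) ?_
  ext γ
  rw [map_mul, map_smul, ContinuousMap.mul_apply, ContinuousMap.smul_apply, gelfand_proj]
  split_ifs with h
  · have : γ ∈ ({β} : Set _) := StoneSpectrum.basicOpen_eq_singleton hP hβ ▸ h
    rw [mem_singleton_iff.1 this, smul_eq_mul]
  · simp

/-- The range of an atom of a maximal abelian von Neumann algebra is one-dimensional. -/
theorem IsMaximalAbelian.exists_range_eq_span (hmax : M.IsMaximalAbelian) {P : Proj M}
    (hP : IsAtom P) : ∃ x : H, P.1.range = ℂ ∙ x := by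
  obtain ⟨β, hβ⟩ := StoneSpectrum.exists_mem_of_isAtom hP
  obtain ⟨x, hx, hx0⟩ := Submodule.exists_mem_ne_zero_of_ne_bot (Proj.range_ne_bot hP.1)
  have hPx : P.1 x = x := (P.apply_eq_self_iff x).2 hx
  have heig : ∀ A : M, A.1 x = gelfand M A β • x := by
    intro A
    have := congrArg (fun T : M => T.1 x) (mul_toElem_of_isAtom hP ((hβ P).2 le_rfl) A)
    change A.1 (P.1 x) = gelfand M A β • P.1 x at this
    rwa [hPx] at this
  have hq : IsStarProjection (ℂ ∙ x).starProjection := isStarProjection_starProjection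
  -- The line through a common eigenvector is invariant under `M`, so its projection commutes with
  -- `M`. Maximality then puts it in `M`, below the atom `P`.
  have hqM' : (ℂ ∙ x).starProjection ∈ M.commutant := by
    refine (IsStarProjection.mem_iff hq _).2 fun A hA => ?_
    rw [commutant_commutant] at hA
    rw [Submodule.range_starProjection]
    intro y hy
    obtain ⟨c, rfl⟩ := Submodule.mem_span_singleton.1 hy
    refine Submodule.mem_span_singleton.2 ⟨c * gelfand M ⟨A, hA⟩ β, ?_⟩
    change _ = A (c • x)
    rw [map_smul, heig ⟨A, hA⟩, smul_smul]
  let Q : Proj M :=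
    ⟨_, hmax.mem_of_commute hq.isSelfAdjoint (mem_commutant_iff.1 hqM'), hq⟩
  have hQ : Q.1.range = ℂ ∙ x := Submodule.range_starProjection _
  have hQP : Q ≤ P := by
    rw [Proj.le_def, hQ]
    exact (Submodule.span_singleton_le_iff_mem _ _).2 hx
  have hQ0 : Q ≠ ⊥ := by
    intro h
    have h1 : Q.1 x = x :=
      (Q.apply_eq_self_iff x).2 (hQ ▸ Submodule.mem_span_singleton_self x)
    rw [h, Proj.coe_bot] at h1
    exact hx0 h1.symm
  exact ⟨x, by rw [← hQ, (hP.le_iff.1 hQP).resolve_left hQ0]⟩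

/-- A quasipoint that contains a projection of finite rank is atomic. -/
theorem mem_atomicPart_of_finiteDimensional {β : StoneSpectrum (Proj M)} {Q : Proj M}
    (hQ : Q ∈ β) (hfin : FiniteDimensional ℂ Q.1.range) :
    β ∈ StoneSpectrum.atomicPart (Proj M) := by
  induction hn : Module.finrank ℂ Q.1.range using Nat.strong_induction_on generalizing Q with
  | _ n ih =>
    have hQ0 : Q ≠ ⊥ := fun h => β.2.1.bot_notMem (h ▸ hQ)
    have key : ∀ R : Proj M, R < Q → R ∈ β → β ∈ StoneSpectrum.atomicPart (Proj M) := by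
      intro R hR hRβ
      have hlt : R.1.range < Q.1.range := hR
      exact ih _ (hn ▸ Submodule.finrank_lt_finrank_of_lt hlt) hRβ
        (Submodule.finiteDimensional_of_le hlt.le) rfl
    by_cases hatom : IsAtom Q
    · exact StoneSpectrum.mem_atomicPart_of_isAtom hatom hQ
    have hex : ∃ R < Q, R ≠ ⊥ := by
      by_contra! h
      exact hatom ⟨hQ0, h⟩
    obtain ⟨R, hRQ, hR0⟩ := hex
    by_cases hR : R ∈ β
    · exact key R hRQ hR
    -- If `Q ⊓ Rᶜ` were equal to `Q`, then `R ≤ Q ≤ Rᶜ` would force `R = ⊥`.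
    · refine key (Q ⊓ Rᶜ) (lt_of_le_of_ne inf_le_left fun h => hR0 ?_)
        (β.2.1.inf_mem _ hQ _ (compl_mem_of_notMem hR))
      have h1 : R ≤ Rᶜ := hRQ.le.trans (inf_eq_left.1 h)
      rw [← inf_compl_eq_bot R, inf_eq_left.2 h1]

/-- The Gelfand transform of a compact operator vanishes on the continuous quasipoints. -/
theorem gelfand_mem_vanishingIdeal {A : M} (hA : A ∈ M.compactIdeal) :
    gelfand M A ∈ M.vanishingIdeal := by
  classical
  intro β hβ
  by_contra hne
  obtain ⟨_, ⟨Q, rfl⟩, hQβ, hQ⟩ :=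
    StoneSpectrum.isTopologicalBasis_basicOpen.exists_subset_of_mem_open
    (show β ∈ {γ | gelfand M A γ ≠ 0} from hne)
    (isOpen_ne_fun (gelfand M A).continuous continuous_const)
  refine hβ (mem_atomicPart_of_finiteDimensional hQβ (Proj.finiteDimensional_range ?_))
  -- The inverse of the transform of `A`, cut off to the clopen set `basicOpen Q`, where that
  -- transform has no zero.
  let g : C(StoneSpectrum (Proj M), ℂ) :=
    ⟨fun γ => (gelfand M Q.toElem γ) * (gelfand M A γ)⁻¹, by
      refine continuous_iff_continuousAt.2 fun γ => ?_
      by_cases h : γ ∈ StoneSpectrum.basicOpen Q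
      · exact (gelfand M Q.toElem).continuous.continuousAt.mul
          ((gelfand M A).continuous.continuousAt.inv₀ (hQ h))
      · refine ContinuousAt.congr (f := fun _ => 0) continuousAt_const ?_
        filter_upwards [(isClopen_basicOpen Q).1.isOpen_compl.mem_nhds h] with δ hδ
        rw [gelfand_proj, if_neg (show Q ∉ δ from hδ), zero_mul]⟩
  obtain ⟨C, hC⟩ := EquivLike.surjective (gelfand M) g
  have hCA : C * A = Q.toElem := by
    refine EquivLike.injective (gelfand M) ?_
    rw [map_mul, hC]
    ext γ
    change gelfand M Q.toElem γ * (gelfand M A γ)⁻¹ * gelfand M A γ = _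
    rw [gelfand_proj]
    split_ifs with h
    · have : gelfand M A γ ≠ 0 := hQ h
      simp [this]
    · simp
  have : Q.1 = C.1 * A.1 := congrArg Subtype.val hCA.symm
  rw [this]
  exact (show IsCompactOperator A.1 from hA).clm_comp C.1

/-- Every function on a finite set of atomic quasipoints, extended by zero, is the Gelfand transform
of a compact operator. -/
theorem IsMaximalAbelian.exists_mem_compactIdeal (hmax : M.IsMaximalAbelian)
    (f : C(StoneSpectrum (Proj M), ℂ)) {s : Set (StoneSpectrum (Proj M))} (hs : s.Finite)
    (hsub : s ⊆ StoneSpectrum.atomicPart (Proj M)) :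
    ∃ A ∈ M.compactIdeal, (∀ β ∈ s, gelfand M A β = f β) ∧ ∀ β ∉ s, gelfand M A β = 0 := by
  classical
  induction s, hs using Set.Finite.induction_on with
  | empty => exact ⟨0, zero_mem _, by simp, by simp⟩
  | @insert γ s hγ _ ih =>
    obtain ⟨A, hA, hAs, hA0⟩ := ih ((subset_insert _ _).trans hsub)
    obtain ⟨P, hP, hPγ⟩ := StoneSpectrum.exists_isAtom_mem (hsub (mem_insert _ _))
    obtain ⟨x, hx⟩ := hmax.exists_range_eq_span hP
    have hmem : ∀ β, P ∈ β ↔ β = γ := fun β =>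
      Set.ext_iff.1 (StoneSpectrum.basicOpen_eq_singleton hP hPγ) β
    have hPc : P.toElem ∈ M.compactIdeal := by
      have : FiniteDimensional ℂ P.1.range := by rw [hx]; infer_instance
      exact Proj.isCompactOperator (P := P)
    -- The transform of `P` is the indicator of `{γ}`, so adding `f γ • P` corrects the value at `γ`
    -- alone.
    have hval : ∀ β, gelfand M (A + f γ • P.toElem) β
        = gelfand M A β + f γ * if β = γ then 1 else 0 := by
      intro β
      rw [map_add, map_smul, ContinuousMap.add_apply, ContinuousMap.smul_apply, gelfand_proj,
        smul_eq_mul]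
      simp only [hmem]
    refine ⟨A + f γ • P.toElem, add_mem hA (SMulMemClass.smul_mem _ hPc), ?_, ?_⟩
    · rintro β (rfl | hβ)
      · rw [hval, hA0 _ hγ]
        simp
      · have : β ≠ γ := fun h => hγ (h ▸ hβ)
        rw [hval, hAs β hβ]
        simp [this]
    · intro β hβ
      rw [mem_insert_iff, not_or] at hβ
      rw [hval, hA0 β hβ.2]
      simp [hβ.1]

/-- Operators whose Gelfand transform vanishes on the continuous quasipoints are compact. -/
theorem IsMaximalAbelian.mem_compactIdeal (hmax : M.IsMaximalAbelian) {A : M}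
    (hA : gelfand M A ∈ M.vanishingIdeal) : A ∈ M.compactIdeal := by
  refine (isClosed_compactIdeal M).closure_subset (Metric.mem_closure_iff.2 fun ε hε => ?_)
  -- Truncating the transform to this finite set costs at most `ε / 2` in supremum norm; the half
  -- turns the non-strict pointwise bound into a distance below `ε`.
  have hsub : {β | ε / 2 ≤ ‖gelfand M A β‖} ⊆ StoneSpectrum.atomicPart (Proj M) := by
    intro β hβ
    by_contra hc
    simp only [mem_ofPred_eq, hA β hc, norm_zero] at hβ
    linarith
  obtain ⟨C, hC, hCs, hC0⟩ := hmax.exists_mem_compactIdeal (gelfand M A)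
    (StoneSpectrum.finite_of_isClosed_of_subset_atomicPart
      (isClosed_le continuous_const (gelfand M A).continuous.norm) hsub) hsub
  refine ⟨C, hC, ?_⟩
  rw [← (isometry_gelfand M).dist_eq]
  refine lt_of_le_of_lt ((ContinuousMap.dist_le (by positivity)).2 fun β => ?_) (half_lt_self hε)
  by_cases hβ : ε / 2 ≤ ‖gelfand M A β‖
  · rw [hCs β hβ, dist_self]
    positivity
  · rw [hC0 β hβ, dist_zero_right]
    exact (not_le.1 hβ).le

/-- The Gelfand transformation, restricted to the compact operators. -/
noncomputable def IsMaximalAbelian.compactIdealEquiv (hmax : M.IsMaximalAbelian) :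
    M.compactIdeal ≃⋆ₐ[ℂ] M.vanishingIdeal where
  toFun A := ⟨gelfand M A, gelfand_mem_vanishingIdeal A.2⟩
  invFun f := ⟨(gelfand M).symm f, hmax.mem_compactIdeal (by
    rw [StarAlgEquiv.apply_symm_apply]
    exact f.2)⟩
  left_inv A := Subtype.ext ((gelfand M).symm_apply_apply _)
  right_inv f := Subtype.ext ((gelfand M).apply_symm_apply _)
  map_mul' A C := Subtype.ext (map_mul (gelfand M) (A : M) C)
  map_add' A C := Subtype.ext (map_add (gelfand M) (A : M) C)
  map_star' A := Subtype.ext (map_star (gelfand M) (A : M))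
  map_smul' c A := Subtype.ext (map_smul (gelfand M) c (A : M))

end Gelfand

end VonNeumannAlgebra

theorem mainTheorem11 {H : Type*} [NormedAddCommGroup H] [InnerProductSpace ℂ H] [CompleteSpace H]
    (hH : ¬ FiniteDimensional ℂ H)
    (B : Set (VonNeumannAlgebra.Proj (VonNeumannAlgebra.full H))) (hB : IsAtomicBooleanSector B)
    (M : VonNeumannAlgebra H) [M.IsAbelian] (hM : M.IsMaximalAbelian)
    (hMB : ∀ P : VonNeumannAlgebra.Proj (VonNeumannAlgebra.full H), P ∈ B ↔ P.1 ∈ M) :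
    -- the atomic quasipoints form an open, discrete and dense subset of the Stone spectrum
    (IsOpen (StoneSpectrum.atomicPart M.Proj) ∧
      DiscreteTopology (StoneSpectrum.atomicPart M.Proj) ∧
      Dense (StoneSpectrum.atomicPart M.Proj)) ∧
    -- both sets of the correspondence are ideals
    (∀ A : M, ∀ K ∈ M.compactIdeal, A * K ∈ M.compactIdeal ∧ K * A ∈ M.compactIdeal) ∧
    (∀ f : C(StoneSpectrum M.Proj, ℂ), ∀ g ∈ M.vanishingIdeal, f * g ∈ M.vanishingIdeal) ∧
    -- the Gelfand transformation restricts to an isometric isomorphism between them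
    (∃ e : M.compactIdeal ≃⋆ₐ[ℂ] M.vanishingIdeal, Isometry e ∧
      ∀ A : M.compactIdeal, (e A : C(StoneSpectrum M.Proj, ℂ)) = M.gelfand (A : M)) ∧
    -- vanishing on the continuous part is vanishing at infinity on the atomic part
    (∀ f : C(StoneSpectrum M.Proj, ℂ), f ∈ M.vanishingIdeal ↔
      Tendsto (fun β : StoneSpectrum.atomicPart M.Proj => f β)
        (cocompact (StoneSpectrum.atomicPart M.Proj)) (𝓝 0)) := by
  -- Atomicity enters through density, for the first and last claims; the isomorphism of ideals
  -- rests on maximality `hM` instead.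
  have hat : IsAtomic M.Proj := VonNeumannAlgebra.Proj.isAtomic_of_isAtomicBooleanSector hB hMB
  refine ⟨⟨StoneSpectrum.isOpen_atomicPart _, inferInstance, StoneSpectrum.dense_atomicPart _⟩,
    fun A K hK => ?_, fun f g hg β hβ => ?_, ⟨hM.compactIdealEquiv, ?_, fun A => rfl⟩,
    fun f => StoneSpectrum.forall_continuousPart_eq_zero_iff f⟩
  · have hK' : IsCompactOperator K.1 := hK
    exact ⟨hK'.clm_comp A.1, hK'.comp_clm A.1⟩
  · rw [ContinuousMap.mul_apply, hg β hβ, mul_zero]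
  · exact fun A C => VonNeumannAlgebra.isometry_gelfand M A C
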